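/- Let $\Omega\subseteq\mathbb R^d$ be any set and let $C(\Omega)$ be the set of continuous real functions on $\Omega$, with the pointwise order and operations. An interval function on $\Omega$ is a map $f=[\underline f,\overline f]$ from $\Omega$ to the compact intervals $[a,b]$ with $a\le b$ real; it is locally bounded if every $x\in\Omega$ has a relative ball $B_\delta(x)=\{y\in\Omega:\|x-y\|<\delta\}$ and an $M\in\mathbb R$ with $\max\{|\underline f(y)|,|\overline f(y)|\}<M$ for all $y\in B_\delta(x)$. For locally bounded $g$ put $$F(g)(x)=\Big[\sup_{\delta>0}\ \inf_{y\in B_\delta(x)}\underline g(y),\ \ \inf_{\delta>0}\ \sup_{y\in B_\delta(x)}\overline g(y)\Big],\qquad x\in\Omega .$$ A locally bounded interval function $f$ is Hausdorff continuous if $F(g)=f$ for every locally bounded interval function $g$ with $g(x)\subseteq f(x)$ for all $x\in\Omega$. Let $\mathbb H(\Omega)$ be the set of Hausdorff continuous interval functions, partially ordered by $f\le g$ iff $\underline f(x)\le\underline g(x)$ and $\overline f(x)\le\overline g(x)$ for all $x\in\Omega$; $C(\Omega)$ is regarded as a subset of $\mathbb H(\Omega)$ via $u\mapsto[u,u]$.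 A sequence $(\xi_n)$ in a partially ordered set $P$ order converges to $\xi\in P$ if there are an increasing sequence $(\alpha_n)$ and a decreasing sequence $(\beta_n)$ in $P$ with $\alpha_n\le\xi_n\le\beta_n$ for all $n$ and $\xi=\sup_n\alpha_n=\inf_n\beta_n$. A sequence $(u_n)$ in $C(\Omega)$ is Cauchy if there is a decreasing sequence $(\beta_n)$ in $C(\Omega)$ whose infimum in $C(\Omega)$ is $0$ and such that $u_m-u_k\le\beta_n$ whenever $m,k\ge n$. Let $f,g\in\mathbb H(\Omega)$. 1. If $(f_n)$ and $(g_n)$ are Cauchy sequences in $C(\Omega)$ that order converge in $\mathbb H(\Omega)$ to $f$ and $g$ respectively, then $(f_n+g_n)$ and $(f_n g_n)$ each order converge in $\mathbb H(\Omega)$, each to exactly one limit. 2. These limits depend only on $f$ and $g$: if $(f^{(i)}_n)$ and $(g^{(i)}_n)$, $i=1,2$, are Cauchy sequences in $C(\Omega)$ that order converge in $\mathbb H(\Omega)$ to $f$ and $g$ respectively, then $(f^{(1)}_n+g^{(1)}_n)$ and $(f^{(2)}_n+g^{(2)}_n)$ have the same order limit, and $(f^{(1)}_n g^{(1)}_n)$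 and $(f^{(2)}_n g^{(2)}_n)$ have the same order limit. -/

import Mathlib

namespace HausdorffContinuous

/-- The modulus `|[a, b]| = max {|a|, |b|}` of a compact real interval. -/
noncomputable def modulus (a : NonemptyInterval ℝ) : ℝ := max |a.fst| |a.snd|

section

variable {X : Type*} [PseudoMetricSpace X]

/-- Locally bounded interval-valued functions. -/
def LocallyBounded (f : X → NonemptyInterval ℝ) : Prop :=
  ∀ x, ∃ δ > 0, ∃ M : ℝ, ∀ y ∈ Metric.ball x δ, modulus (f y) < M

/-- The lower Baire operator `I(f)(x) = sup_{δ > 0} inf {f(y) : y ∈ B_δ(x)}`. It is computed in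
the extended reals, since the infimum over a large ball may be `-∞`. -/
noncomputable def lowerBaire (f : X → NonemptyInterval ℝ) (x : X) : EReal :=
  ⨆ δ : ℝ, ⨆ _ : 0 < δ, ⨅ y ∈ Metric.ball x δ, ((f y).fst : EReal)

/-- The upper Baire operator `S(f)(x) = inf_{δ > 0} sup {f(y) : y ∈ B_δ(x)}`. It is computed in
the extended reals, since the supremum over a large ball may be `+∞`. -/
noncomputable def upperBaire (f : X → NonemptyInterval ℝ) (x : X) : EReal :=
  ⨅ δ : ℝ, ⨅ _ : 0 < δ, ⨆ y ∈ Metric.ball x δ, ((f y).snd : EReal)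

/-- `F(g) = f`: the graph completion `F(g)(x) = [I(g)(x), S(g)(x)]` of `g` is `f`. -/
def GraphCompletionEq (g f : X → NonemptyInterval ℝ) : Prop :=
  ∀ x, lowerBaire g x = ((f x).fst : EReal) ∧ upperBaire g x = ((f x).snd : EReal)

/-- Hausdorff continuity of an interval-valued function: `f` is locally bounded, and every locally
bounded `g` with `g(x) ⊆ f(x)` for all `x` satisfies `F(g) = f`. -/
def IsHContinuous (f : X → NonemptyInterval ℝ) : Prop :=
  LocallyBounded f ∧
    ∀ g : X → NonemptyInterval ℝ, LocallyBounded g →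
      (∀ x, (g x : Set ℝ) ⊆ (f x : Set ℝ)) → GraphCompletionEq g f

end

/-- The set `ℍ(X)` of all Hausdorff continuous interval functions on `X`. -/
structure HFun (X : Type*) [PseudoMetricSpace X] where
  toFun : X → NonemptyInterval ℝ
  isHContinuous : IsHContinuous toFun

/-- The order on `ℍ(X)`: pointwise, with `[a, b] ≤ [c, d]` iff `a ≤ c` and `b ≤ d`
(not the inclusion order that Mathlib puts on intervals). -/
instance {X : Type*} [PseudoMetricSpace X] : PartialOrder (HFun X) where
  le f g := ∀ x, (f.toFun x).fst ≤ (g.toFun x).fst ∧ (f.toFun x).snd ≤ (g.toFun x).snd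
  le_refl _ _ := ⟨le_rfl, le_rfl⟩
  le_trans _ _ _ h₁ h₂ x := ⟨(h₁ x).1.trans (h₂ x).1, (h₁ x).2.trans (h₂ x).2⟩
  le_antisymm f g h₁ h₂ := by
    obtain ⟨f, hf⟩ := f
    obtain ⟨g, hg⟩ := g
    have : f = g := funext fun x => NonemptyInterval.ext
      (Prod.ext ((h₁ x).1.antisymm (h₂ x).1) ((h₁ x).2.antisymm (h₂ x).2))
    subst this
    rfl

/-- A continuous real function, seen as a function with point-interval values, is Hausdorff
continuous. -/
theorem isHContinuous_pure {X : Type*} [PseudoMetricSpace X] (u : C(X, ℝ)) :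
    IsHContinuous fun x => NonemptyInterval.pure (u x) := by
  have key : ∀ x, ∀ ε > 0, ∃ δ > 0, ∀ y ∈ Metric.ball x δ, |u y - u x| < ε := by
    intro x ε hε
    obtain ⟨δ, hδ, h⟩ := Metric.continuous_iff.1 u.continuous x ε hε
    exact ⟨δ, hδ, fun y hy => by simpa [Real.dist_eq] using h y hy⟩
  refine ⟨fun x => ?_, fun g _ hg => ?_⟩
  · obtain ⟨δ, hδ, h⟩ := key x 1 one_pos
    refine ⟨δ, hδ, |u x| + 1, fun y hy => ?_⟩
    have h1 := h y hy
    have h2 := abs_sub_abs_le_abs_sub (u y) (u x)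
    change max |u y| |u y| < |u x| + 1
    rw [max_self]
    linarith
  · have hpt : ∀ y, (g y).fst = u y ∧ (g y).snd = u y := by
      intro y
      have h1 : (g y).fst ∈ (NonemptyInterval.pure (u y) : Set ℝ) :=
        hg y ⟨le_rfl, (g y).fst_le_snd⟩
      have h2 : (g y).snd ∈ (NonemptyInterval.pure (u y) : Set ℝ) :=
        hg y ⟨(g y).fst_le_snd, le_rfl⟩
      simpa using And.intro h1 h2
    intro x
    change lowerBaire g x = (u x : EReal) ∧ upperBaire g x = (u x : EReal)
    simp only [lowerBaire, upperBaire, hpt]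
    constructor
    · apply le_antisymm
      · exact iSup₂_le fun δ hδ => iInf₂_le x (Metric.mem_ball_self hδ)
      · refine EReal.ge_of_forall_gt_iff_ge.1 fun z hz => ?_
        obtain ⟨δ, hδ, h⟩ := key x (u x - z) (sub_pos.2 (EReal.coe_lt_coe_iff.1 hz))
        refine le_iSup₂_of_le δ hδ (le_iInf₂ fun y hy => ?_)
        have := (abs_lt.1 (h y hy)).1
        exact EReal.coe_le_coe_iff.2 (by linarith)
    · apply le_antisymm
      · refine EReal.le_of_forall_lt_iff_le.1 fun z hz => ?_
        obtain ⟨δ, hδ, h⟩ := key x (z - u x) (sub_pos.2 (EReal.coe_lt_coe_iff.1 hz))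
        refine iInf₂_le_of_le δ hδ (iSup₂_le fun y hy => ?_)
        have := (abs_lt.1 (h y hy)).2
        exact EReal.coe_le_coe_iff.2 (by linarith)
      · exact le_iInf₂ fun δ hδ => le_iSup₂_of_le x (Metric.mem_ball_self hδ) le_rfl

/-- The embedding of `C(X)` into `ℍ(X)`, `u ↦ [u, u]`. -/
def ofContinuous {X : Type*} [PseudoMetricSpace X] (u : C(X, ℝ)) : HFun X :=
  ⟨fun x => NonemptyInterval.pure (u x), isHContinuous_pure u⟩

/-- Order convergence of a sequence in a partially ordered set. -/
def OrderConverges {P : Type*} [PartialOrder P] (ξ : ℕ → P) (p : P) : Prop :=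
  ∃ α β : ℕ → P, Monotone α ∧ Antitone β ∧ (∀ n, α n ≤ ξ n ∧ ξ n ≤ β n) ∧
    IsLUB (Set.range α) p ∧ IsGLB (Set.range β) p

/-- Cauchy sequences in `C(X)`: there is a decreasing sequence `β` in `C(X)` with infimum `0` in
the ordered set `C(X)` and `u m - u k ≤ β n` for all `m, k ≥ n`. -/
def IsCauchySequence {X : Type*} [PseudoMetricSpace X] (u : ℕ → C(X, ℝ)) : Prop :=
  ∃ β : ℕ → C(X, ℝ), Antitone β ∧ IsGLB (Set.range β) 0 ∧
    ∀ n m k, n ≤ m → n ≤ k → u m - u k ≤ β n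

/-- `u` is a Cauchy sequence in `C(X)` that order converges to `f` in `ℍ(X)`. -/
def CauchyConverges {X : Type*} [PseudoMetricSpace X] (u : ℕ → C(X, ℝ)) (f : HFun X) : Prop :=
  IsCauchySequence u ∧ OrderConverges (fun n => ofContinuous (u n)) f

end HausdorffContinuous

open HausdorffContinuous

open Filter Topology

namespace HausdorffContinuous

/-! ### Order limits in a partially ordered set. -/

section OrderConvergence

variable {P : Type*} [PartialOrder P]

/-! Order limits are unique in any partial order, and sums and products of Cauchy sequences in
`C(X)` are again Cauchy. Part 1 thus reduces to `IsCauchySequence.exists_orderConverges`. If `γ`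
controls `u`, the running maxima of `u k - γ k` and running minima of `u k + γ k` enclose `u`. The
maxima have a supremum in `ℍ(X)`, built from semicontinuous envelopes. It is also the infimum of the
minima: `γ` need not tend to `0` pointwise, but it becomes arbitrarily small somewhere in every
neighbourhood, and an envelope only sees neighbourhoods.

For part 2, two Cauchy sequences with the same limit interlace to a Cauchy sequence. Sums and
products of interlaced sequences therefore converge, and the two sequences to be compared are their
even and odd subsequences. -/

theorem OrderConverges.le_of_le {ξ η : ℕ → P} {p q : P} (hξ : OrderConverges ξ p)
    (hη : OrderConverges η q) (h : ∀ n, ξ n ≤ η n) : p ≤ q := by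
  obtain ⟨α, _, hα, _, h₁, hp, _⟩ := hξ
  obtain ⟨_, β, _, hβ, h₂, _, hq⟩ := hη
  refine hp.2 ?_
  rintro _ ⟨n, rfl⟩
  refine hq.2 ?_
  rintro _ ⟨m, rfl⟩
  calc α n ≤ α (max n m) := hα (le_max_left _ _)
    _ ≤ ξ (max n m) := (h₁ _).1
    _ ≤ η (max n m) := h _
    _ ≤ β (max n m) := (h₂ _).2
    _ ≤ β m := hβ (le_max_right _ _)

theorem OrderConverges.unique {ξ : ℕ → P} {p q : P} (hp : OrderConverges ξ p)
    (hq : OrderConverges ξ q) : p = q :=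
  (hp.le_of_le hq fun _ => le_rfl).antisymm (hq.le_of_le hp fun _ => le_rfl)

theorem OrderConverges.comp_strictMono {ξ : ℕ → P} {p : P} (h : OrderConverges ξ p)
    {φ : ℕ → ℕ} (hφ : StrictMono φ) : OrderConverges (fun n => ξ (φ n)) p := by
  obtain ⟨α, β, hα, hβ, h, hp, hq⟩ := h
  refine ⟨fun n => α (φ n), fun n => β (φ n), hα.comp hφ.monotone,
    hβ.comp_monotone hφ.monotone, fun n => h _, ⟨?_, fun b hb => hp.2 ?_⟩,
    ⟨?_, fun b hb => hq.2 ?_⟩⟩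
  · rintro _ ⟨n, rfl⟩
    exact hp.1 ⟨_, rfl⟩
  · rintro _ ⟨n, rfl⟩
    exact (hα hφ.le_apply).trans (hb ⟨n, rfl⟩)
  · rintro _ ⟨n, rfl⟩
    exact hq.1 ⟨_, rfl⟩
  · rintro _ ⟨n, rfl⟩
    exact (hb ⟨n, rfl⟩).trans (hβ hφ.le_apply)

end OrderConvergence

/-! ### Cauchy sequences in `C(X)`: sums and products. -/

section CauchySequences

variable {X : Type*} [PseudoMetricSpace X]

/-- Sequences in `C(X)` decreasing to `0` in the ordered set `C(X)`. -/
def DecreasesToZero (β : ℕ → C(X, ℝ)) : Prop :=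
  Antitone β ∧ IsGLB (Set.range β) 0

theorem DecreasesToZero.nonneg {β : ℕ → C(X, ℝ)} (h : DecreasesToZero β) (n : ℕ) : 0 ≤ β n :=
  h.2.1 ⟨n, rfl⟩

theorem DecreasesToZero.le_zero {β : ℕ → C(X, ℝ)} (h : DecreasesToZero β) {w : C(X, ℝ)}
    (hw : ∀ n, w ≤ β n) : w ≤ 0 := by
  refine h.2.2 ?_
  rintro _ ⟨n, rfl⟩
  exact hw n

theorem DecreasesToZero.mk' {β : ℕ → C(X, ℝ)} (h : Antitone β) (h₀ : ∀ n, 0 ≤ β n)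
    (h₁ : ∀ w : C(X, ℝ), (∀ n, w ≤ β n) → w ≤ 0) : DecreasesToZero β := by
  refine ⟨h, ?_, fun w hw => h₁ w fun n => hw ⟨n, rfl⟩⟩
  rintro _ ⟨n, rfl⟩
  exact h₀ n

theorem DecreasesToZero.add {β γ : ℕ → C(X, ℝ)} (hβ : DecreasesToZero β)
    (hγ : DecreasesToZero γ) : DecreasesToZero fun n => β n + γ n := by
  refine .mk' (fun m n h => add_le_add (hβ.1 h) (hγ.1 h))
    (fun n => add_nonneg (hβ.nonneg n) (hγ.nonneg n)) fun w hw => ?_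
  refine hγ.le_zero fun m => ?_
  rw [← sub_nonpos]
  refine hβ.le_zero fun n => ?_
  rw [sub_le_iff_le_add]
  exact (hw (max n m)).trans
    (add_le_add (hβ.1 (le_max_left _ _)) (hγ.1 (le_max_right _ _)))

/-- Since `a * β n ≤ (1 + a) * β n` and `1 + a` never vanishes, dividing a lower bound of the
products by `1 + a` gives a continuous lower bound of `β`. -/
theorem DecreasesToZero.mul_left {β : ℕ → C(X, ℝ)} (hβ : DecreasesToZero β) {a : C(X, ℝ)}
    (ha : 0 ≤ a) : DecreasesToZero fun n => a * β n := by
  have ha' : ∀ x, 0 ≤ a x := fun x => ha x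
  have hpos : ∀ x, 0 < 1 + a x := fun x => by linarith [ha' x]
  refine .mk' (fun m n h x => mul_le_mul_of_nonneg_left (hβ.1 h x) (ha' x))
    (fun n x => mul_nonneg (ha' x) (hβ.nonneg n x)) fun w hw => ?_
  let w' : C(X, ℝ) := ⟨fun x => w x / (1 + a x),
    w.continuous.div (continuous_const.add a.continuous) fun x => (hpos x).ne'⟩
  have h : w' ≤ 0 := hβ.le_zero fun n x => by
    change w x / (1 + a x) ≤ β n x
    rw [div_le_iff₀ (hpos x)]
    have h₁ : w x ≤ a x * β n x := hw n x
    have h₂ : 0 ≤ β n x := hβ.nonneg n x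
    linarith
  intro x
  have hx : w x / (1 + a x) ≤ 0 := h x
  rw [div_le_iff₀ (hpos x), zero_mul] at hx
  exact hx

theorem DecreasesToZero.comp {β : ℕ → C(X, ℝ)} (hβ : DecreasesToZero β) {φ : ℕ → ℕ}
    (hφ : Monotone φ) (hφ' : Tendsto φ atTop atTop) : DecreasesToZero fun n => β (φ n) := by
  refine .mk' (hβ.1.comp_monotone hφ) (fun n => hβ.nonneg _) fun w hw => hβ.le_zero fun n => ?_
  obtain ⟨m, hm⟩ := (hφ'.eventually_ge_atTop n).exists
  exact (hw m).trans (hβ.1 hm)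

/-- A sequence decreasing to `0` is not bounded away from `0` on any neighbourhood. -/
theorem DecreasesToZero.exists_lt {β : ℕ → C(X, ℝ)} (hβ : DecreasesToZero β) {x : X} {s : Set X}
    (hs : s ∈ 𝓝 x) {ε : ℝ} (hε : 0 < ε) : ∃ n, ∃ y ∈ s, β n y < ε := by
  by_contra! hcon
  obtain ⟨r, hr, hball⟩ := Metric.mem_nhds_iff.1 hs
  -- A cone of height `ε` over the ball: a lower bound of `β` that is positive at `x`.
  let w : C(X, ℝ) := ⟨fun y => ε * max 0 (1 - dist y x / r), by fun_prop⟩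
  have h : w ≤ 0 := hβ.le_zero fun n y => by
    change ε * max 0 (1 - dist y x / r) ≤ β n y
    by_cases hy : y ∈ Metric.ball x r
    · refine le_trans ?_ (hcon n y (hball hy))
      have : 0 ≤ dist y x / r := by positivity
      have : max 0 (1 - dist y x / r) ≤ 1 := max_le zero_le_one (by linarith)
      nlinarith
    · have : 1 ≤ dist y x / r := by
        rw [one_le_div hr]
        simpa using hy
      rw [max_eq_left (by linarith), mul_zero]
      exact hβ.nonneg n y
  have hx : ε * max 0 (1 - dist x x / r) ≤ 0 := h x
  simp at hx
  linarith

theorem isCauchySequence_iff {u : ℕ → C(X, ℝ)} : IsCauchySequence u ↔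
    ∃ β, DecreasesToZero β ∧ ∀ n m k, n ≤ m → n ≤ k → u m - u k ≤ β n :=
  ⟨fun ⟨β, h₁, h₂, h₃⟩ => ⟨β, ⟨h₁, h₂⟩, h₃⟩, fun ⟨β, h₁, h₃⟩ => ⟨β, h₁.1, h₁.2, h₃⟩⟩

theorem IsCauchySequence.add {u v : ℕ → C(X, ℝ)} (hu : IsCauchySequence u)
    (hv : IsCauchySequence v) : IsCauchySequence fun n => u n + v n := by
  rw [isCauchySequence_iff] at *
  obtain ⟨β, hβ, hu⟩ := hu
  obtain ⟨γ, hγ, hv⟩ := hv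
  refine ⟨_, hβ.add hγ, fun n m k hm hk => ?_⟩
  rw [add_sub_add_comm]
  exact add_le_add (hu n m k hm hk) (hv n m k hm hk)

theorem IsCauchySequence.exists_abs_le {u : ℕ → C(X, ℝ)} (hu : IsCauchySequence u) :
    ∃ a : C(X, ℝ), ∀ n x, |u n x| ≤ a x := by
  obtain ⟨β, -, hu⟩ := isCauchySequence_iff.1 hu
  refine ⟨|u 0| + β 0, fun n x => ?_⟩
  have h₁ : u n x - u 0 x ≤ β 0 x := hu 0 n 0 (Nat.zero_le _) le_rfl x
  have h₂ : u 0 x - u n x ≤ β 0 x := hu 0 0 n le_rfl (Nat.zero_le _) x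
  change |u n x| ≤ |u 0 x| + β 0 x
  have := abs_sub_abs_le_abs_sub (u n x) (u 0 x)
  have : |u n x - u 0 x| ≤ β 0 x := abs_le.2 ⟨by linarith, h₁⟩
  linarith

theorem IsCauchySequence.mul {u v : ℕ → C(X, ℝ)} (hu : IsCauchySequence u)
    (hv : IsCauchySequence v) : IsCauchySequence fun n => u n * v n := by
  obtain ⟨a, ha⟩ := hu.exists_abs_le
  obtain ⟨b, hb⟩ := hv.exists_abs_le
  have ha₀ : 0 ≤ a := fun x => (abs_nonneg _).trans (ha 0 x)
  have hb₀ : 0 ≤ b := fun x => (abs_nonneg _).trans (hb 0 x)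
  rw [isCauchySequence_iff] at *
  obtain ⟨β, hβ, hu⟩ := hu
  obtain ⟨γ, hγ, hv⟩ := hv
  refine ⟨_, (hγ.mul_left ha₀).add (hβ.mul_left hb₀), fun n m k hm hk x => ?_⟩
  change u m x * v m x - u k x * v k x ≤ a x * γ n x + b x * β n x
  have h₁ : |v m x - v k x| ≤ γ n x :=
    abs_le.2 ⟨by linarith [show v k x - v m x ≤ γ n x from hv n k m hk hm x],
      hv n m k hm hk x⟩
  have h₂ : |u m x - u k x| ≤ β n x :=
    abs_le.2 ⟨by linarith [show u k x - u m x ≤ β n x from hu n k m hk hm x],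
      hu n m k hm hk x⟩
  calc u m x * v m x - u k x * v k x
      = u m x * (v m x - v k x) + v k x * (u m x - u k x) := by ring
    _ ≤ |u m x * (v m x - v k x)| + |v k x * (u m x - u k x)| :=
      add_le_add (le_abs_self _) (le_abs_self _)
    _ ≤ a x * γ n x + b x * β n x := by
      rw [abs_mul, abs_mul]
      exact add_le_add (mul_le_mul (ha m x) h₁ (abs_nonneg _) (ha₀ x))
        (mul_le_mul (hb k x) h₂ (abs_nonneg _) (hb₀ x))

end CauchySequences

/-! ### Semicontinuous envelopes and order limits in `ℍ(X)`. -/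

section HausdorffContinuity

variable {X : Type*} [PseudoMetricSpace X]

theorem lowerBaire_eq_liminf (f : X → NonemptyInterval ℝ) (x : X) :
    lowerBaire f x = liminf (fun y => ((f y).fst : EReal)) (𝓝 x) :=
  (Metric.nhds_basis_ball.liminf_eq_iSup_iInf).symm

theorem upperBaire_eq_limsup (f : X → NonemptyInterval ℝ) (x : X) :
    upperBaire f x = limsup (fun y => ((f y).snd : EReal)) (𝓝 x) :=
  (Metric.nhds_basis_ball.limsup_eq_iInf_iSup).symm

theorem liminf_nhds_le (h : X → EReal) (x : X) : liminf h (𝓝 x) ≤ h x := by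
  refine le_of_forall_lt fun c hc => ?_
  exact (eventually_lt_of_lt_liminf hc).self_of_nhds

theorem le_limsup_nhds (h : X → EReal) (x : X) : h x ≤ limsup h (𝓝 x) := by
  refine le_of_forall_gt fun c hc => ?_
  exact (eventually_lt_of_limsup_lt hc).self_of_nhds

theorem eventually_le_liminf_nhds {h : X → EReal} {x : X} {c : EReal}
    (hc : c < liminf h (𝓝 x)) : ∀ᶠ y in 𝓝 x, c ≤ liminf h (𝓝 y) :=
  (eventually_eventually_nhds.2 (eventually_lt_of_lt_liminf hc)).mono fun _ hy =>
    le_liminf_of_le (h := hy.mono fun _ hz => hz.le)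

theorem eventually_limsup_nhds_le {h : X → EReal} {x : X} {c : EReal}
    (hc : limsup h (𝓝 x) < c) : ∀ᶠ y in 𝓝 x, limsup h (𝓝 y) ≤ c :=
  (eventually_eventually_nhds.2 (eventually_lt_of_limsup_lt hc)).mono fun _ hy =>
    limsup_le_of_le (h := hy.mono fun _ hz => hz.le)

theorem liminf_nhds_liminf_nhds (h : X → EReal) (x : X) :
    liminf (fun y => liminf h (𝓝 y)) (𝓝 x) = liminf h (𝓝 x) := by
  refine (liminf_nhds_le _ x).antisymm (le_of_forall_lt_imp_le_of_dense fun c hc => ?_)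
  exact le_liminf_of_le (h := eventually_le_liminf_nhds hc)

theorem limsup_nhds_limsup_nhds (h : X → EReal) (x : X) :
    limsup (fun y => limsup h (𝓝 y)) (𝓝 x) = limsup h (𝓝 x) := by
  refine le_antisymm (le_of_forall_gt_imp_ge_of_dense fun c hc => ?_) (le_limsup_nhds (fun y => limsup h (𝓝 y)) x)
  exact limsup_le_of_le (h := eventually_limsup_nhds_le hc)

/-- Hausdorff continuity in terms of the end point functions: the lower one is the lower
semicontinuous envelope of the upper one, and vice versa. -/
theorem isHContinuous_iff {f : X → NonemptyInterval ℝ} : IsHContinuous f ↔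
    LocallyBounded f ∧
      (∀ x, liminf (fun y => ((f y).snd : EReal)) (𝓝 x) = (f x).fst) ∧
      ∀ x, limsup (fun y => ((f y).fst : EReal)) (𝓝 x) = (f x).snd := by
  constructor
  · rintro ⟨hb, h⟩
    refine ⟨hb, fun x => ?_, fun x => ?_⟩
    -- The end points themselves, as point intervals, are the test functions `g ⊆ f`.
    · have := (h (fun y => NonemptyInterval.pure (f y).snd) (fun x => ?_) (fun x => ?_) x).1
      · rwa [lowerBaire_eq_liminf] at this
      · obtain ⟨δ, hδ, M, hM⟩ := hb x
        refine ⟨δ, hδ, M, fun y hy => lt_of_le_of_lt ?_ (hM y hy)⟩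
        exact max_le (le_max_right _ _) (le_max_right _ _)
      · intro z hz
        have : z = (f x).snd := by simpa using hz
        rw [this]
        exact ⟨(f x).fst_le_snd, le_rfl⟩
    · have := (h (fun y => NonemptyInterval.pure (f y).fst) (fun x => ?_) (fun x => ?_) x).2
      · rwa [upperBaire_eq_limsup] at this
      · obtain ⟨δ, hδ, M, hM⟩ := hb x
        refine ⟨δ, hδ, M, fun y hy => lt_of_le_of_lt ?_ (hM y hy)⟩
        exact max_le (le_max_left _ _) (le_max_left _ _)
      · intro z hz
        have : z = (f x).fst := by simpa using hz
        rw [this]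
        exact ⟨le_rfl, (f x).fst_le_snd⟩
  · rintro ⟨hb, hl, hu⟩
    refine ⟨hb, fun g _ hg x => ?_⟩
    have hg₁ : ∀ y, (f y).fst ≤ (g y).fst := fun y => (hg y ⟨le_rfl, (g y).fst_le_snd⟩).1
    have hg₂ : ∀ y, (g y).snd ≤ (f y).snd := fun y => (hg y ⟨(g y).fst_le_snd, le_rfl⟩).2
    rw [lowerBaire_eq_liminf, upperBaire_eq_limsup]
    refine ⟨le_antisymm ?_ ?_, le_antisymm ?_ ?_⟩
    · rw [← hl x]
      exact liminf_le_liminf (.of_forall fun y =>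
        EReal.coe_le_coe_iff.2 ((g y).fst_le_snd.trans (hg₂ y)))
    -- The lower end point of `f` is a lower envelope, hence its own lower envelope.
    · rw [← hl x, ← liminf_nhds_liminf_nhds]
      refine liminf_le_liminf (.of_forall fun y => ?_)
      rw [hl y]
      exact EReal.coe_le_coe_iff.2 (hg₁ y)
    · rw [← hu x, ← limsup_nhds_limsup_nhds (fun y => ((f y).fst : EReal))]
      refine limsup_le_limsup (.of_forall fun y => ?_)
      beta_reduce
      rw [hu y]
      exact EReal.coe_le_coe_iff.2 (hg₂ y)
    · rw [← hu x]
      exact limsup_le_limsup (.of_forall fun y =>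
        EReal.coe_le_coe_iff.2 ((hg₁ y).trans (g y).fst_le_snd))

theorem HFun.liminf_snd (f : HFun X) (x : X) :
    liminf (fun y => ((f.toFun y).snd : EReal)) (𝓝 x) = (f.toFun x).fst :=
  (isHContinuous_iff.1 f.isHContinuous).2.1 x

theorem HFun.limsup_fst (f : HFun X) (x : X) :
    limsup (fun y => ((f.toFun y).fst : EReal)) (𝓝 x) = (f.toFun x).snd :=
  (isHContinuous_iff.1 f.isHContinuous).2.2 x

/-- The upper end point determines the lower one through a monotone operation. -/
theorem HFun.le_of_snd_le {f g : HFun X} (h : ∀ x, (f.toFun x).snd ≤ (g.toFun x).snd) :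
    f ≤ g := fun x => by
  refine ⟨EReal.coe_le_coe_iff.1 ?_, h x⟩
  rw [← f.liminf_snd, ← g.liminf_snd]
  exact liminf_le_liminf (.of_forall fun y => EReal.coe_le_coe_iff.2 (h y))

theorem ofContinuous_mono {u v : C(X, ℝ)} (h : u ≤ v) : ofContinuous u ≤ ofContinuous v :=
  fun x => ⟨h x, h x⟩

/-- A pointwise bounded increasing sequence of continuous functions has a supremum in `ℍ(X)`,
whose upper end point function is the upper semicontinuous envelope of the pointwise supremum. -/
theorem exists_isLUB_ofContinuous {α : ℕ → C(X, ℝ)} {b : C(X, ℝ)} (hb : ∀ n, α n ≤ b) :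
    ∃ p : HFun X, IsLUB (Set.range fun n => ofContinuous (α n)) p ∧
      ∀ x, ((p.toFun x).snd : EReal) = limsup (fun y => ⨆ n, (α n y : EReal)) (𝓝 x) := by
  set A : X → EReal := fun y => ⨆ n, (α n y : EReal)
  set T : X → EReal := fun x => limsup A (𝓝 x)
  set L : X → EReal := fun x => liminf T (𝓝 x) with hL
  have hLT : ∀ x, L x ≤ T x := fun x => liminf_nhds_le T x
  have hAT : ∀ x, A x ≤ T x := fun x => le_limsup_nhds A x
  -- `A` is lower semicontinuous, being a supremum of continuous functions, and `A ≤ T`.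
  have hAL : ∀ x, A x ≤ L x := fun x => by
    refine le_of_forall_lt_imp_le_of_dense fun c hc => ?_
    obtain ⟨n, hn⟩ := lt_iSup_iff.1 hc
    have hcont : ContinuousAt (fun y => (α n y : EReal)) x :=
      (continuous_coe_real_ereal.comp (α n).continuous).continuousAt
    refine le_liminf_of_le (h := (hcont.eventually_const_lt hn).mono fun y hy => ?_)
    exact hy.le.trans ((le_iSup (fun n => (α n y : EReal)) n).trans (hAT y))
  have hTb : ∀ x, T x ≤ b x := fun x => by
    have hcont : Tendsto (fun y => (b y : EReal)) (𝓝 x) (𝓝 (b x : EReal)) :=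
      (continuous_coe_real_ereal.comp b.continuous).continuousAt
    rw [← hcont.limsup_eq]
    exact limsup_le_limsup (.of_forall fun y => iSup_le fun n => EReal.coe_le_coe_iff.2 (hb n y))
  have hαA : ∀ n x, (α n x : EReal) ≤ A x := fun n x => le_iSup (fun n => (α n x : EReal)) n
  -- `A ≤ L ≤ T`, and both `A` and `T` have upper envelope `T`.
  have hlimsup : ∀ x, limsup L (𝓝 x) = T x := fun x => by
    refine le_antisymm ?_ (limsup_le_limsup (.of_forall hAL))
    exact (limsup_le_limsup (.of_forall hLT)).trans_eq (limsup_nhds_limsup_nhds A x)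
  have hTr : ∀ x, ((T x).toReal : EReal) = T x := fun x =>
    EReal.coe_toReal ((hTb x).trans_lt (EReal.coe_lt_top _)).ne
      ((EReal.bot_lt_coe _).trans_le ((hαA 0 x).trans (hAT x))).ne'
  have hLr : ∀ x, ((L x).toReal : EReal) = L x := fun x =>
    EReal.coe_toReal (((hLT x).trans (hTb x)).trans_lt (EReal.coe_lt_top _)).ne
      ((EReal.bot_lt_coe _).trans_le ((hαA 0 x).trans (hAL x))).ne'
  let P : X → NonemptyInterval ℝ := fun x => ⟨((L x).toReal, (T x).toReal), by
    rw [← EReal.coe_le_coe_iff, hTr, hLr]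
    exact hLT x⟩
  have hP₁ : ∀ x, ((P x).fst : EReal) = L x := hLr
  have hP₂ : ∀ x, ((P x).snd : EReal) = T x := hTr
  have hαP : ∀ n x, α n x ≤ (P x).fst := fun n x => by
    rw [← EReal.coe_le_coe_iff, hP₁]
    exact (hαA n x).trans (hAL x)
  have hPb : ∀ x, (P x).snd ≤ b x := fun x => by
    rw [← EReal.coe_le_coe_iff, hP₂]
    exact hTb x
  have hbdd : LocallyBounded P := fun x => by
    have hcont : ContinuousAt (fun y => |α 0 y| + |b y|) x := by fun_prop
    obtain ⟨δ, hδ, h⟩ := Metric.eventually_nhds_iff_ball.1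
      (hcont.eventually_lt_const (lt_add_one _))
    refine ⟨δ, hδ, _, fun y hy => lt_of_le_of_lt ?_ (h y hy)⟩
    have h₁ := hαP 0 y
    have h₂ := hPb y
    have h₃ := (P y).fst_le_snd
    have h₄ := neg_abs_le (α 0 y)
    have h₅ := le_abs_self (b y)
    have h₆ := abs_nonneg (α 0 y)
    have h₇ := abs_nonneg (b y)
    exact max_le (abs_le.2 ⟨by linarith, by linarith⟩) (abs_le.2 ⟨by linarith, by linarith⟩)
  have hH : IsHContinuous P := isHContinuous_iff.2 ⟨hbdd,
    fun x => by simp only [hP₁, hP₂, hL], fun x => by simp only [hP₁, hP₂, hlimsup]⟩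
  refine ⟨⟨P, hH⟩, ⟨?_, fun q hq => HFun.le_of_snd_le fun x => ?_⟩, hP₂⟩
  · rintro _ ⟨n, rfl⟩
    exact fun x => ⟨hαP n x, (hαP n x).trans (P x).fst_le_snd⟩
  · rw [← EReal.coe_le_coe_iff, hP₂, ← q.limsup_fst]
    exact limsup_le_limsup (.of_forall fun y => iSup_le fun n =>
      EReal.coe_le_coe_iff.2 (hq ⟨n, rfl⟩ y).1)

/-- If `α n ≤ β m` for all `n, m` and `β n - α n` is bounded by a sequence decreasing to `0`, then
the supremum of `α` and the infimum of `β` in `ℍ(X)` exist and coincide. -/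
theorem exists_isLUB_isGLB {α β γ : ℕ → C(X, ℝ)} (hαβ : ∀ n m, α n ≤ β m)
    (hγ : DecreasesToZero γ) (h : ∀ n, β n ≤ α n + γ n) :
    ∃ p : HFun X, IsLUB (Set.range fun n => ofContinuous (α n)) p ∧
      IsGLB (Set.range fun n => ofContinuous (β n)) p := by
  obtain ⟨p, hp, hsnd⟩ := exists_isLUB_ofContinuous (fun n => hαβ n 0)
  refine ⟨p, hp, ?_, fun q hq => HFun.le_of_snd_le fun x => ?_⟩
  · rintro _ ⟨m, rfl⟩
    refine hp.2 ?_
    rintro _ ⟨n, rfl⟩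
    exact ofContinuous_mono (hαβ n m)
  -- Choose `c < e` between the two upper end points. Near `x` every `α n` stays below `c`, while
  -- arbitrarily near `x` some `y` has a neighbourhood where `q.snd`, hence every `β n`, exceeds
  -- `e`. There `γ n` would stay above `e - c` for all `n`.
  by_contra! hlt
  obtain ⟨c, hc₁, hc₂⟩ := exists_between hlt
  obtain ⟨e, he₁, he₂⟩ := exists_between hc₂
  have hA : ∀ᶠ y in 𝓝 x, (⨆ n, (α n y : EReal)) < c := by
    refine eventually_lt_of_limsup_lt ?_
    rw [← hsnd]
    exact EReal.coe_lt_coe_iff.2 hc₁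
  have hq' : ∃ᶠ y in 𝓝 x, (e : EReal) < (q.toFun y).fst := by
    refine frequently_lt_of_lt_limsup (h := ?_)
    rw [q.limsup_fst]
    exact EReal.coe_lt_coe_iff.2 he₂
  obtain ⟨y, hy, hyA⟩ := (hq'.and_eventually (eventually_eventually_nhds.2 hA)).exists
  rw [← q.liminf_snd] at hy
  obtain ⟨n, z, ⟨hz₁, hz₂⟩, hz⟩ := hγ.exists_lt
    ((eventually_lt_of_lt_liminf hy).and hyA) (sub_pos.2 he₁)
  have h₁ : e < (q.toFun z).snd := EReal.coe_lt_coe_iff.1 hz₁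
  have h₂ : (q.toFun z).snd ≤ β n z := (hq ⟨n, rfl⟩ z).2
  have h₃ : α n z < c :=
    EReal.coe_lt_coe_iff.1 ((le_iSup (fun n => (α n z : EReal)) n).trans_lt hz₂)
  have h₄ : β n z ≤ α n z + γ n z := h n z
  linarith

/-- Every Cauchy sequence in `C(X)` order converges in `ℍ(X)`. -/
theorem IsCauchySequence.exists_orderConverges {u : ℕ → C(X, ℝ)} (hu : IsCauchySequence u) :
    ∃ p : HFun X, OrderConverges (fun n => ofContinuous (u n)) p := by
  obtain ⟨γ, hγ, hu⟩ := isCauchySequence_iff.1 hu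
  let α : ℕ → C(X, ℝ) := fun n => partialSups (fun k => u k - γ k) n
  -- The double negation turns running maxima into running minima.
  let β : ℕ → C(X, ℝ) := fun n => -partialSups (fun k => -(u k + γ k)) n
  have hα : Monotone α := (partialSups _).monotone
  have hβ : Antitone β := fun m n h => neg_le_neg ((partialSups _).monotone h)
  have hαu : ∀ n, α n ≤ u n := fun n => partialSups_le _ _ _ fun k hk =>
    sub_le_comm.1 (hu k k n le_rfl hk |>.trans' (by simp))
  have huβ : ∀ n, u n ≤ β n := fun n => le_neg_of_le_neg <| partialSups_le _ _ _ fun k hk =>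
    neg_le_neg (sub_le_iff_le_add'.1 (hu k n k hk le_rfl))
  have hγα : ∀ n, u n - γ n ≤ α n := fun n => le_partialSups (fun k => u k - γ k) n
  have hβγ : ∀ n, β n ≤ u n + γ n := fun n =>
    neg_le.1 (le_partialSups (fun k => -(u k + γ k)) n)
  obtain ⟨p, hp₁, hp₂⟩ := exists_isLUB_isGLB (α := α) (β := β)
    (fun n m => (hα (le_max_left n m)).trans <| (hαu _).trans <| (huβ _).trans <|
      hβ (le_max_right n m))
    (hγ.add hγ) fun n => (hβγ n).trans (by
      have := sub_le_iff_le_add.1 (hγα n)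
      rw [← add_assoc]
      gcongr)
  exact ⟨p, fun n => ofContinuous (α n), fun n => ofContinuous (β n),
    fun m n h => ofContinuous_mono (hα h), fun m n h => ofContinuous_mono (hβ h),
    fun n => ⟨ofContinuous_mono (hαu n), ofContinuous_mono (huβ n)⟩, hp₁, hp₂⟩

theorem IsCauchySequence.existsUnique_orderConverges {u : ℕ → C(X, ℝ)}
    (hu : IsCauchySequence u) :
    ∃! p : HFun X, OrderConverges (fun n => ofContinuous (u n)) p :=
  hu.exists_orderConverges.imp fun _ hp => ⟨hp, fun _ hq => hq.unique hp⟩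

/-! ### Interlacing sequences with a common limit. -/

theorem ofContinuous_sub_le_of_orderConverges {u γ : ℕ → C(X, ℝ)} {f : HFun X}
    (hu : ∀ n m k, n ≤ m → n ≤ k → u m - u k ≤ γ n)
    (hf : OrderConverges (fun n => ofContinuous (u n)) f) (n : ℕ) :
    ofContinuous (u n - γ n) ≤ f := by
  obtain ⟨_, β, _, hβ, h, _, hinf⟩ := hf
  refine hinf.2 ?_
  rintro _ ⟨m, rfl⟩
  have h₁ : u n - γ n ≤ u (max n m) := sub_le_comm.1 (hu n n _ le_rfl (le_max_left _ _))
  exact (ofContinuous_mono h₁).trans ((h _).2.trans (hβ (le_max_right _ _)))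

theorem le_ofContinuous_add_of_orderConverges {u γ : ℕ → C(X, ℝ)} {f : HFun X}
    (hu : ∀ n m k, n ≤ m → n ≤ k → u m - u k ≤ γ n)
    (hf : OrderConverges (fun n => ofContinuous (u n)) f) (n : ℕ) :
    f ≤ ofContinuous (u n + γ n) := by
  obtain ⟨α, _, hα, _, h, hsup, _⟩ := hf
  refine hsup.2 ?_
  rintro _ ⟨m, rfl⟩
  have h₁ : u (max n m) ≤ u n + γ n :=
    sub_le_iff_le_add'.1 (hu n _ n (le_max_left _ _) le_rfl)
  exact ((hα (le_max_right _ _)).trans (h _).1).trans (ofContinuous_mono h₁)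

/-- The sequence `u 0, v 0, u 1, v 1, …`. -/
def interlace {α : Type*} (u v : ℕ → α) (n : ℕ) : α :=
  if Even n then u (n / 2) else v (n / 2)

theorem interlace_even {α : Type*} (u v : ℕ → α) (n : ℕ) : interlace u v (2 * n) = u n := by
  simp [interlace]

theorem interlace_odd {α : Type*} (u v : ℕ → α) (n : ℕ) : interlace u v (2 * n + 1) = v n := by
  have : (2 * n + 1) / 2 = n := by omega
  simp [interlace, this]

/-- The common limit mediates: `u m - β m ≤ f ≤ v k + γ k`. -/
theorem sub_le_of_orderConverges {u v β γ : ℕ → C(X, ℝ)} {f : HFun X}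
    (hβ : Antitone β) (hγ : Antitone γ)
    (hu : ∀ n m k, n ≤ m → n ≤ k → u m - u k ≤ β n)
    (hv : ∀ n m k, n ≤ m → n ≤ k → v m - v k ≤ γ n)
    (huf : OrderConverges (fun n => ofContinuous (u n)) f)
    (hvf : OrderConverges (fun n => ofContinuous (v n)) f) {n m k : ℕ} (hm : n ≤ m)
    (hk : n ≤ k) : u m - v k ≤ β n + γ n := fun x => by
  have h₁ : u m x - β m x ≤ v k x + γ k x :=
    (((ofContinuous_sub_le_of_orderConverges hu huf m).trans
      (le_ofContinuous_add_of_orderConverges hv hvf k)) x).1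
  have h₂ : β m x ≤ β n x := hβ hm x
  have h₃ : γ k x ≤ γ n x := hγ hk x
  change u m x - v k x ≤ β n x + γ n x
  linarith

/-- Cauchy sequences with the same order limit in `ℍ(X)` interlace to a Cauchy sequence. -/
theorem CauchyConverges.interlace {u v : ℕ → C(X, ℝ)} {f : HFun X} (hu : CauchyConverges u f)
    (hv : CauchyConverges v f) : IsCauchySequence (interlace u v) := by
  obtain ⟨hu, huf⟩ := hu
  obtain ⟨hv, hvf⟩ := hv
  rw [isCauchySequence_iff] at *
  obtain ⟨β, hβ, hu⟩ := hu
  obtain ⟨γ, hγ, hv⟩ := hv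
  -- Entry `n` of the interlaced sequence is entry `n / 2` of `u` or `v`, so the bound is slowed
  -- down accordingly.
  refine ⟨_, (hβ.add hγ).comp (φ := fun n => n / 2) (fun m n h => Nat.div_le_div_right h)
    (Nat.tendsto_div_const_atTop two_ne_zero), fun n m k hm hk => ?_⟩
  have hm' : n / 2 ≤ m / 2 := Nat.div_le_div_right hm
  have hk' : n / 2 ≤ k / 2 := Nat.div_le_div_right hk
  unfold HausdorffContinuous.interlace
  split_ifs
  · exact (hu _ _ _ hm' hk').trans (le_add_of_nonneg_right (hγ.nonneg _))
  · exact sub_le_of_orderConverges hβ.1 hγ.1 hu hv huf hvf hm' hk'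
  · exact (sub_le_of_orderConverges hγ.1 hβ.1 hv hu hvf huf hm' hk').trans_eq (add_comm _ _)
  · exact (hv _ _ _ hm' hk').trans (le_add_of_nonneg_left (hβ.nonneg _))

theorem eq_of_isCauchySequence_even_odd {u v w : ℕ → C(X, ℝ)} (hw : IsCauchySequence w)
    (hu : ∀ n, w (2 * n) = u n) (hv : ∀ n, w (2 * n + 1) = v n) {p q : HFun X}
    (hp : OrderConverges (fun n => ofContinuous (u n)) p)
    (hq : OrderConverges (fun n => ofContinuous (v n)) q) : p = q := by
  obtain ⟨r, hr⟩ := hw.exists_orderConverges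
  have h₁ := hr.comp_strictMono (φ := fun n => 2 * n) fun m n h => by dsimp only; omega
  have h₂ := hr.comp_strictMono (φ := fun n => 2 * n + 1) fun m n h => by dsimp only; omega
  simp only [hu] at h₁
  simp only [hv] at h₂
  exact (hp.unique h₁).trans (h₂.unique hq)

end HausdorffContinuity

end HausdorffContinuous

theorem mainTheorem6 {d : ℕ} (Ω : Set (EuclideanSpace ℝ (Fin d))) (f g : HFun Ω) :
    (∀ u v : ℕ → C(Ω, ℝ), CauchyConverges u f → CauchyConverges v g →
      (∃! p : HFun Ω, OrderConverges (fun n => ofContinuous (u n + v n)) p) ∧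
      (∃! q : HFun Ω, OrderConverges (fun n => ofContinuous (u n * v n)) q)) ∧
    (∀ u₁ u₂ v₁ v₂ : ℕ → C(Ω, ℝ),
      CauchyConverges u₁ f → CauchyConverges u₂ f →
      CauchyConverges v₁ g → CauchyConverges v₂ g →
      (∀ p₁ p₂ : HFun Ω,
        OrderConverges (fun n => ofContinuous (u₁ n + v₁ n)) p₁ →
        OrderConverges (fun n => ofContinuous (u₂ n + v₂ n)) p₂ → p₁ = p₂) ∧
      (∀ q₁ q₂ : HFun Ω,
        OrderConverges (fun n => ofContinuous (u₁ n * v₁ n)) q₁ →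
        OrderConverges (fun n => ofContinuous (u₂ n * v₂ n)) q₂ → q₁ = q₂)) := by
  refine ⟨fun u v hu hv => ⟨(hu.1.add hv.1).existsUnique_orderConverges,
    (hu.1.mul hv.1).existsUnique_orderConverges⟩, fun u₁ u₂ v₁ v₂ hu₁ hu₂ hv₁ hv₂ =>
    ⟨fun p₁ p₂ => ?_, fun q₁ q₂ => ?_⟩⟩
  -- Termwise addition commutes with interlacing.
  · exact eq_of_isCauchySequence_even_odd ((hu₁.interlace hu₂).add (hv₁.interlace hv₂))
      (fun n => by simp only [interlace_even]) (fun n => by simp only [interlace_odd])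
  · exact eq_of_isCauchySequence_even_odd ((hu₁.interlace hu₂).mul (hv₁.interlace hv₂))
      (fun n => by simp only [interlace_even]) (fun n => by simp only [interlace_odd])
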